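/- Let $\kappa$ be an infinite cardinal number and let $A$ be a set with $\operatorname{card} A \le 2^{\kappa}$ and $\operatorname{card} A \notin \{2,3,4,5,6,7\}$. Then there exists a symmetric relation $R \subseteq A \times A$ satisfying the following condition $(\kappa^{\diamond})$: for every $x \in A$ there is a set $A(x)$ with $\{x\} \subseteq A(x) \subseteq A$ and $\operatorname{card} A(x) \le \kappa$ such that no map $f : A(x) \to A$ with $f \neq \mathrm{id}_{A(x)}$ is a homomorphism of $R$, where $f$ is called a homomorphism of $R$ if $(f(a),f(b)) \in R$ for all $a,b \in A(x)$ with $(a,b) \in R$. -/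

import Mathlib

universe u

/-- A map `f : S → A`, defined on a subset `S` of `A`, is a homomorphism of the relation `R` on `A`
if it preserves `R`: whenever `a, b ∈ S` and `R a b`, then `R (f a) (f b)`. -/
def IsHomOn {A : Type u} (R : A → A → Prop) (S : Set A) (f : S → A) : Prop :=
  ∀ a b : S, R a b → R (f a) (f b)

/-- Condition `(κ^⋄)`: every `x : A` lies in a subset `S` of `A` of cardinality at most `κ` such that
no map `f : S → A` other than the identity (the inclusion of `S` in `A`) is a homomorphism of `R`. -/
def DiamondCondition {A : Type u} (κ : Cardinal.{u}) (R : A → A → Prop) : Prop :=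
  ∀ x : A, ∃ S : Set A, {x} ⊆ S ∧ Cardinal.mk S ≤ κ ∧
    ∀ f : S → A, f ≠ (fun a : S => (a : A)) → ¬ IsHomOn R S f

/-! A finite A carries a rigid graph and A(x) = A; if card A ≤ 1 the empty relation is enough. Sizes
n ≥ 8 come from two graphs checked by search, squared paths with two extra edges (`strip_rigid`),
and cones over such graphs.

For infinite A, take a well-order I with a top and min(κ, card A) elements. The coding graph has a
rigid strip whose vertices mark the sorts of all others, vertices coding the order of I and ladders
(cofinal ω-sequences below points that have one), and for each y in A a vertex joined to an
antichain member N y ⊆ I. Only strip vertices lie in triangles, so homomorphisms fix the strip and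
preserve sorts. They induce strictly increasing maps of I commuting with the ladders, hence the
identity (`StrictMono.eq_of_ladder`); the antichain then fixes every y. All but the last kind of
vertices number at most κ, and together with x they form A(x). -/

/-- A binary relation is rigid if it is symmetric and the identity is its only endomorphism. -/
def RigidRel {V : Type*} (R : V → V → Prop) : Prop :=
  (∀ a b, R a b → R b a) ∧ ∀ f : V → V, (∀ a b, R a b → R (f a) (f b)) → ∀ a, f a = a

/-! ### Two small rigid graphs -/

/-- The symmetric relation on `Fin n` with the given list of edges. -/
def edgeRel (L : List (ℕ × ℕ)) (n : ℕ) (i j : Fin n) : Prop :=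
  (i.val, j.val) ∈ L ∨ (j.val, i.val) ∈ L

instance (L : List (ℕ × ℕ)) (n : ℕ) : DecidableRel (edgeRel L n) := fun _ _ =>
  inferInstanceAs (Decidable (_ ∨ _))

/-- The edges of a rigid graph on eight vertices. -/
def edges8 : List (ℕ × ℕ) :=
  [(0, 1), (0, 2), (0, 3), (0, 4), (1, 2), (1, 3), (1, 6), (2, 4), (2, 6), (2, 7), (3, 5), (4, 5),
    (4, 7), (5, 6), (5, 7)]

/-- The edges of a rigid graph on ten vertices. -/
def edges10 : List (ℕ × ℕ) :=
  [(0, 1), (0, 2), (0, 4), (0, 5), (1, 2), (1, 3), (1, 4), (2, 3), (2, 7), (2, 9), (3, 6), (3, 7),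
    (4, 5), (4, 6), (4, 7), (5, 6), (5, 7), (5, 8), (5, 9), (6, 8), (7, 9), (8, 9)]

theorem edgeRel_symm (L : List (ℕ × ℕ)) (n : ℕ) (a b : Fin n) (h : edgeRel L n a b) :
    edgeRel L n b a := Or.symm h

-- Each vertex is constrained by its edges to earlier ones before the next is chosen, so the search
-- over homomorphic images is pruned early.
set_option synthInstance.maxSize 2000 in
theorem edges8_search : ∀ a b : Fin 8, edgeRel edges8 8 a b →
    ∀ c, edgeRel edges8 8 a c ∧ edgeRel edges8 8 b c →
    ∀ d, edgeRel edges8 8 a d ∧ edgeRel edges8 8 b d →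
    ∀ e, edgeRel edges8 8 a e ∧ edgeRel edges8 8 c e →
    ∀ g, edgeRel edges8 8 d g ∧ edgeRel edges8 8 e g →
    ∀ h, edgeRel edges8 8 b h ∧ edgeRel edges8 8 c h ∧ edgeRel edges8 8 g h →
    ∀ i, edgeRel edges8 8 c i ∧ edgeRel edges8 8 e i ∧ edgeRel edges8 8 g i →
    a = 0 ∧ b = 1 ∧ c = 2 ∧ d = 3 ∧ e = 4 ∧ g = 5 ∧ h = 6 ∧ i = 7 := by
  decide +kernel

set_option synthInstance.maxHeartbeats 200000 in
set_option synthInstance.maxSize 10000 in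
theorem edges10_search : ∀ a b : Fin 10, edgeRel edges10 10 a b →
    ∀ c, edgeRel edges10 10 a c ∧ edgeRel edges10 10 b c →
    ∀ d, edgeRel edges10 10 b d ∧ edgeRel edges10 10 c d →
    ∀ e, edgeRel edges10 10 a e ∧ edgeRel edges10 10 b e →
    ∀ g, edgeRel edges10 10 a g ∧ edgeRel edges10 10 e g →
    ∀ h, edgeRel edges10 10 d h ∧ edgeRel edges10 10 e h ∧ edgeRel edges10 10 g h →
    ∀ i, edgeRel edges10 10 c i ∧ edgeRel edges10 10 d i ∧ edgeRel edges10 10 e i ∧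
      edgeRel edges10 10 g i →
    ∀ j, edgeRel edges10 10 g j ∧ edgeRel edges10 10 h j →
    ∀ k, edgeRel edges10 10 c k ∧ edgeRel edges10 10 g k ∧ edgeRel edges10 10 i k ∧
      edgeRel edges10 10 j k →
    a = 0 ∧ b = 1 ∧ c = 2 ∧ d = 3 ∧ e = 4 ∧ g = 5 ∧ h = 6 ∧ i = 7 ∧ j = 8 ∧ k = 9 := by
  decide +kernel

theorem rigidRel_edges8 : RigidRel (edgeRel edges8 8) := by
  refine ⟨edgeRel_symm _ _, fun f hf => ?_⟩
  obtain ⟨h0, h1, h2, h3, h4, h5, h6, h7⟩ := edges8_search (f 0) (f 1) (hf _ _ (by decide))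
    (f 2) ⟨hf _ _ (by decide), hf _ _ (by decide)⟩
    (f 3) ⟨hf _ _ (by decide), hf _ _ (by decide)⟩
    (f 4) ⟨hf _ _ (by decide), hf _ _ (by decide)⟩
    (f 5) ⟨hf _ _ (by decide), hf _ _ (by decide)⟩
    (f 6) ⟨hf _ _ (by decide), hf _ _ (by decide), hf _ _ (by decide)⟩
    (f 7) ⟨hf _ _ (by decide), hf _ _ (by decide), hf _ _ (by decide)⟩
  intro a
  fin_cases a <;> assumption

theorem rigidRel_edges10 : RigidRel (edgeRel edges10 10) := by
  refine ⟨edgeRel_symm _ _, fun f hf => ?_⟩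
  obtain ⟨h0, h1, h2, h3, h4, h5, h6, h7, h8, h9⟩ := edges10_search (f 0) (f 1) (hf _ _ (by decide))
    (f 2) ⟨hf _ _ (by decide), hf _ _ (by decide)⟩
    (f 3) ⟨hf _ _ (by decide), hf _ _ (by decide)⟩
    (f 4) ⟨hf _ _ (by decide), hf _ _ (by decide)⟩
    (f 5) ⟨hf _ _ (by decide), hf _ _ (by decide)⟩
    (f 6) ⟨hf _ _ (by decide), hf _ _ (by decide), hf _ _ (by decide)⟩
    (f 7) ⟨hf _ _ (by decide), hf _ _ (by decide), hf _ _ (by decide),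
      hf _ _ (by decide)⟩
    (f 8) ⟨hf _ _ (by decide), hf _ _ (by decide)⟩
    (f 9) ⟨hf _ _ (by decide), hf _ _ (by decide), hf _ _ (by decide),
      hf _ _ (by decide)⟩
  intro a
  fin_cases a <;> assumption

/-! ### Cones -/

/-- The cone over a relation: a new vertex `none` related to all the old ones. -/
def coneRel {V : Type*} (R : V → V → Prop) : Option V → Option V → Prop
  | some a, some b => R a b
  | none, none => False
  | _, _ => True

/-- If the apex moves to an old vertex u, replacing the apex by u in the values on old vertices
gives an endomorphism of R. It is the identity, so u is related to every other vertex, against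
`huniv`. -/
theorem RigidRel.cone {V : Type*} {R : V → V → Prop} (hR : RigidRel R) (hirr : ∀ a, ¬ R a a)
    (huniv : ∀ a, ∃ b, b ≠ a ∧ ¬ R a b) : RigidRel (coneRel R) := by
  classical
  have hsymm : ∀ a b, coneRel R a b → coneRel R b a := by
    rintro (_ | a) (_ | b) h
    · exact h
    · trivial
    · trivial
    · exact hR.1 _ _ h
  have hirr' : ∀ a, ¬ coneRel R a a := by
    rintro (_ | a) h
    · exact h
    · exact hirr a h
  refine ⟨hsymm, fun f hf => ?_⟩
  rcases hu : f none with _ | u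
  · have hne : ∀ a, ∃ b, f (some a) = some b := by
      intro a
      rcases h : f (some a) with _ | b
      · have := hf none (some a) trivial
        rw [hu, h] at this
        exact this.elim
      · exact ⟨b, rfl⟩
    choose g hg using hne
    have hid := hR.2 g (fun a b hab => by
      have := hf (some a) (some b) hab
      rwa [hg, hg] at this)
    rintro (_ | a)
    · exact hu
    · rw [hg, hid]
  · exfalso
    have hadj : ∀ a b, f (some a) = some b → R u b := by
      intro a b h
      have := hf none (some a) trivial
      rwa [hu, h] at this
    have hid := hR.2 (fun a => (f (some a)).getD u) (fun a b hab => by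
      have h := hf (some a) (some b) hab
      show R ((f (some a)).getD u) ((f (some b)).getD u)
      rcases ha : f (some a) with _ | a' <;> rcases hb : f (some b) with _ | b' <;>
        rw [ha, hb] at h
      · exact h.elim
      · exact hadj _ _ hb
      · exact hR.1 _ _ (hadj _ _ ha)
      · exact h)
    obtain ⟨b, hbu, hb⟩ := huniv u
    have h := hid b
    rcases hfb : f (some b) with _ | c
    · simp only [hfb, Option.getD_none] at h
      exact hbu h.symm
    · simp only [hfb, Option.getD_some] at h
      exact hb (h ▸ hadj _ _ hfb)

/-! ### Squared paths with two extra edges -/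

/-- Adjacency in the square of the path on `ℕ`. -/
def stripAdj (x y : ℕ) : Prop := (x < y ∧ y ≤ x + 2) ∨ (y < x ∧ x ≤ y + 2)

/-- The square of a path on `0, …, n - 1` with the additional edges `0 — 6` and `b — (n - 1)`. -/
def stripRel (b n : ℕ) (x y : ℕ) : Prop :=
  stripAdj x y ∨ (x = 0 ∧ y = 6) ∨ (x = 6 ∧ y = 0) ∨ (x = b ∧ y + 1 = n) ∨ (x + 1 = n ∧ y = b)

theorem stripRel_symm {b n x y : ℕ} (h : stripRel b n x y) : stripRel b n y x := by
  unfold stripRel stripAdj at *; omega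

theorem stripRel_irrefl {b n : ℕ} (hb : b = 1 ∨ b = 2) (hn : 11 ≤ n) (x : ℕ) :
    ¬ stripRel b n x x := by
  unfold stripRel stripAdj; omega

/-- The two extra edges lie in no triangle. -/
theorem stripAdj_of_triangle {b n x y z : ℕ} (hb : b = 1 ∨ b = 2) (hn : 11 ≤ n)
    (hxy : stripRel b n x y) (hyz : stripRel b n y z) (hxz : stripRel b n x z) :
    stripAdj x y := by
  rcases hxy with h | h | h | h | h
  · exact h
  all_goals unfold stripRel stripAdj at *; omega

theorem stripAdj.symm {x y : ℕ} (h : stripAdj x y) : stripAdj y x := Or.symm h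

theorem strip_between {p x y : ℕ} (h1 : stripAdj p x) (h2 : stripAdj p y)
    (h3 : stripAdj x (p + 3)) (h4 : stripAdj y (p + 3)) (h5 : stripAdj x y) :
    x = p + 1 ∧ y = p + 2 ∨ x = p + 2 ∧ y = p + 1 := by
  unfold stripAdj at *
  omega

section

variable {n : ℕ} {f : ℕ → ℕ}

/-- Both f i and f (i + 3) are common neighbours of the adjacent vertices f (i + 1) and f (i + 2),
and such neighbours are equal or differ by 3. -/
theorem strip_step (h1 : ∀ i, i + 1 < n → stripAdj (f i) (f (i + 1)))
    (h2 : ∀ i, i + 2 < n → stripAdj (f i) (f (i + 2))) (i : ℕ) (hi : i + 3 < n) :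
    f (i + 3) = f i ∨ f (i + 3) = f i + 3 ∨ f (i + 3) + 3 = f i := by
  have a1 := h1 i (by omega)
  have a2 := h1 (i + 1) (by omega)
  have a3 := h1 (i + 2) (by omega)
  have a4 := h2 i (by omega)
  have a5 := h2 (i + 1) (by omega)
  simp only [add_assoc, Nat.reduceAdd] at *
  unfold stripAdj at *
  omega

theorem strip_walk (h1 : ∀ i, i + 1 < n → stripAdj (f i) (f (i + 1)))
    (h2 : ∀ i, i + 2 < n → stripAdj (f i) (f (i + 2))) (i k : ℕ) (hi : i + 3 * k < n) :
    f (i + 3 * k) % 3 = f i % 3 ∧ f (i + 3 * k) ≤ f i + 3 * k ∧ f i ≤ f (i + 3 * k) + 3 * k := by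
  induction k with
  | zero => simp
  | succ k ih =>
    have := ih (by omega)
    have h := strip_step h1 h2 (i + 3 * k) (by omega)
    rw [show i + 3 * (k + 1) = i + 3 * k + 3 by ring]
    omega

theorem strip_rigid {b : ℕ} (hb : b = 1 ∨ b = 2) (hn : 11 ≤ n) (hbn : 3 ∣ n - 1 - b)
    (h1 : ∀ i, i + 1 < n → stripAdj (f i) (f (i + 1)))
    (h2 : ∀ i, i + 2 < n → stripAdj (f i) (f (i + 2)))
    (h3 : stripRel b n (f 0) (f 6)) (h4 : stripRel b n (f b) (f (n - 1))) :
    ∀ i, i < n → f i = i := by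
  have w := strip_walk h1 h2
  have s := strip_step h1 h2
  obtain ⟨m, hm⟩ := hbn
  have w6 := w 0 2 (by omega)
  have s0 := s 0 (by omega)
  have s1 := s 1 (by omega)
  have s2 := s 2 (by omega)
  have s3 := s 3 (by omega)
  have wb := w b m (by omega)
  have e01 := h1 0 (by omega)
  have e12 := h1 1 (by omega)
  have e23 := h1 2 (by omega)
  have e34 := h1 3 (by omega)
  have e45 := h1 4 (by omega)
  have e56 := h1 5 (by omega)
  have e02 := h2 0 (by omega)
  have e13 := h2 1 (by omega)
  have e24 := h2 2 (by omega)
  have e35 := h2 3 (by omega)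
  have e46 := h2 4 (by omega)
  simp only [Nat.reduceAdd, Nat.reduceMul, zero_add] at *
  rw [show b + 3 * m = n - 1 by omega] at wb
  -- By `strip_walk` the ends are congruent mod 3, which only the extra edges allow, and b — (n - 1)
  -- is longer than 6.
  have hends : (f 0 = 0 ∧ f 6 = 6) ∨ (f 0 = 6 ∧ f 6 = 0) := by
    clear * - h3 w6 hn hb
    unfold stripRel stripAdj at h3
    omega
  have hid : f 0 = 0 ∧ f 1 = 1 ∧ f 2 = 2 ∧ f 3 = 3 ∧ f 4 = 4 ∧ f 5 = 5 ∧ f 6 = 6 := by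
    rcases hends with ⟨a0, a6⟩ | ⟨a0, a6⟩
    · have a3 : f 3 = 3 := by clear * - a0 a6 s0 s3; omega
      rw [a0] at e01 e02
      rw [a3] at e23 e34 e35 e13
      rw [a6] at e56 e46
      have a12 := strip_between e01 e02 e13 e23 e12
      have a45 := strip_between e34 e35 e46 e56 e45
      clear * - a0 a3 a6 a12 a45 e24
      unfold stripAdj at e24
      omega
    · exfalso
      have a3 : f 3 = 3 := by clear * - a0 a6 s0 s3; omega
      rw [a0] at e01 e02
      rw [a3] at e23 e34 e35 e13
      rw [a6] at e56 e46
      have a12 := strip_between e13.symm e23.symm e01.symm e02.symm e12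
      have a45 := strip_between e46.symm e56.symm e34.symm e35.symm e45
      -- The reflection sends b to 5 or 4, neither of which has a neighbour congruent to it mod 3,
      -- as f (n - 1) would be.
      have a : f 1 = 5 ∧ f 2 = 4 := by
        clear * - a12 a45 e24
        unfold stripAdj at e24
        omega
      clear * - a hb hn h4 wb
      unfold stripRel stripAdj at h4
      rcases hb with rfl | rfl <;> omega
  clear s0 s1 s2 s3 e01 e12 e23 e34 e45 e56 e02 e13 e24 e35 e46
  have hfb : f b = b := by rcases hb with rfl | rfl <;> omega
  have hlast : f (n - 1) = n - 1 := by
    unfold stripRel stripAdj at h4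
    omega
  -- Going from b to n - 1 in m steps of length at most 3 leaves no slack.
  have hcol : ∀ k, b + 3 * k < n → f (b + 3 * k) = b + 3 * k := by
    intro k hk
    have hkm : k ≤ m := by omega
    obtain ⟨d, rfl⟩ := Nat.exists_eq_add_of_le hkm
    have w1 := w b k hk
    have w2 := w (b + 3 * k) d (by omega)
    rw [show b + 3 * k + 3 * d = n - 1 by omega] at w2
    omega
  intro i
  induction i using Nat.strong_induction_on with
  | _ i ih =>
    intro hi
    by_cases hi6 : i ≤ 6
    · interval_cases i <;> omega
    obtain ⟨j, rfl⟩ : ∃ j, i = j + 3 := ⟨i - 3, by omega⟩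
    have c0 := ih j (by omega) (by omega)
    have c1 := ih (j + 1) (by omega) (by omega)
    have c2 := ih (j + 2) (by omega) (by omega)
    have t := s j hi
    have u1 := h2 (j + 1) (by omega)
    simp only [add_assoc, Nat.reduceAdd] at *
    have hj : f (j + 3) = j ∨ f (j + 3) = j + 3 := by
      unfold stripAdj at u1
      omega
    rcases hj with hj | hj
    -- One of j + 3, j + 4, j + 5 is in the fixed column of b, too far from the folded value j.
    · exfalso
      by_cases r0 : (j + 3) % 3 = b % 3
      · have := hcol ((j + 3 - b) / 3) (by omega)
        rw [show b + 3 * ((j + 3 - b) / 3) = j + 3 by omega] at this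
        omega
      by_cases r1 : (j + 4) % 3 = b % 3
      · have := hcol ((j + 4 - b) / 3) (by omega)
        rw [show b + 3 * ((j + 4 - b) / 3) = j + 4 by omega] at this
        have v := h1 (j + 3) (by omega)
        simp only [add_assoc, Nat.reduceAdd] at v
        unfold stripAdj at v
        omega
      · have := hcol ((j + 5 - b) / 3) (by omega)
        rw [show b + 3 * ((j + 5 - b) / 3) = j + 5 by omega] at this
        have v := h2 (j + 3) (by omega)
        simp only [add_assoc, Nat.reduceAdd] at v
        unfold stripAdj at v
        omega
    · exact hj

end

theorem rigidRel_strip {b n : ℕ} (hb : b = 1 ∨ b = 2) (hn : 11 ≤ n) (hbn : 3 ∣ n - 1 - b) :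
    RigidRel (fun x y : Fin n => stripRel b n x y) := by
  refine ⟨fun _ _ h => stripRel_symm h, fun f hf a => ?_⟩
  have hS : ∀ x y : Fin n, ∀ z : Fin n, stripAdj x y → stripAdj y z → stripAdj x z →
      stripAdj (f x) (f y) ∧ stripAdj (f x) (f z) := by
    intro x y z hxy hyz hxz
    have h1 := hf x y (Or.inl hxy)
    have h2 := hf y z (Or.inl hyz)
    have h3 := hf x z (Or.inl hxz)
    exact ⟨stripAdj_of_triangle hb hn h1 h2 h3, stripAdj_of_triangle hb hn h3 (stripRel_symm h2) h1⟩
  let g : ℕ → ℕ := fun i => if h : i < n then f ⟨i, h⟩ else 0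
  have hg : ∀ i (h : i < n), g i = f ⟨i, h⟩ := fun i h => dif_pos h
  have key := strip_rigid (n := n) (f := g) hb hn hbn ?_ ?_ ?_ ?_ a a.2
  · rw [hg _ a.2] at key
    exact Fin.ext key
  · intro i hi
    rw [hg i (by omega), hg (i + 1) hi]
    by_cases h : i + 2 < n
    · exact (hS ⟨i, by omega⟩ ⟨i + 1, hi⟩ ⟨i + 2, h⟩ (by simp [stripAdj]) (by simp [stripAdj])
        (by simp [stripAdj])).1
    -- The last edge of the path gets its triangle from i - 1.
    · have := (hS ⟨i, by omega⟩ ⟨i - 1, by omega⟩ ⟨i + 1, hi⟩ (by simp [stripAdj]; omega)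
        (by simp [stripAdj]; omega) (by simp [stripAdj])).2
      exact this
  · intro i hi
    rw [hg i (by omega), hg (i + 2) hi]
    exact (hS ⟨i, by omega⟩ ⟨i + 1, by omega⟩ ⟨i + 2, hi⟩ (by simp [stripAdj]) (by simp [stripAdj])
      (by simp [stripAdj])).2
  · rw [hg 0 (by omega), hg 6 (by omega)]
    exact hf _ _ (by simp [stripRel])
  · rw [hg b (by omega), hg (n - 1) (by omega)]
    refine hf _ _ (Or.inr (Or.inr (Or.inr (Or.inl ⟨rfl, ?_⟩))))
    simp only
    omega

theorem exists_rigidRel_fin {n : ℕ} (hn : 8 ≤ n) : ∃ R : Fin n → Fin n → Prop, RigidRel R := by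
  have transport : ∀ {V : Type} {R : V → V → Prop} (e : Fin n ≃ V), RigidRel R →
      ∃ R : Fin n → Fin n → Prop, RigidRel R := by
    intro V R e hR
    refine ⟨fun a b => R (e a) (e b), fun a b h => hR.1 _ _ h, fun f hf a => ?_⟩
    have := hR.2 (fun v => e (f (e.symm v))) (fun a b hab => hf _ _ (by simpa using hab)) (e a)
    simpa using this
  by_cases h8 : n = 8
  · subst h8; exact ⟨_, rigidRel_edges8⟩
  by_cases h10 : n = 10
  · subst h10; exact ⟨_, rigidRel_edges10⟩
  by_cases h9 : n = 9
  · subst h9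
    exact transport (finSuccEquiv 8) (rigidRel_edges8.cone (by decide) (by decide))
  by_cases m2 : n % 3 = 2
  · exact ⟨_, rigidRel_strip (b := 1) (Or.inl rfl) (by omega) (by omega)⟩
  by_cases m0 : n % 3 = 0
  · exact ⟨_, rigidRel_strip (b := 2) (Or.inr rfl) (by omega) (by omega)⟩
  -- For n ≡ 1 mod 3 neither b satisfies the divisibility, so a cone is taken; each strip vertex
  -- misses 7, 1 or 3.
  obtain ⟨m, rfl⟩ : ∃ m, n = m + 1 := ⟨n - 1, by omega⟩
  refine transport (finSuccEquiv m) ((rigidRel_strip (b := 2) (n := m) (Or.inr rfl) (by omega)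
    (by omega)).cone (fun a => stripRel_irrefl (Or.inr rfl) (by omega) a) fun a => ?_)
  by_cases h : a.val ≤ 4
  · refine ⟨⟨7, by omega⟩, fun h => ?_, ?_⟩
    · have := congrArg Fin.val h
      simp only at this
      omega
    · simp only [stripRel, stripAdj]; omega
  by_cases h' : a.val ≤ 6
  · refine ⟨⟨1, by omega⟩, fun h => ?_, ?_⟩
    · have := congrArg Fin.val h
      simp only at this
      omega
    · simp only [stripRel, stripAdj]; omega
  · refine ⟨⟨3, by omega⟩, fun h => ?_, ?_⟩
    · have := congrArg Fin.val h
      simp only at this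
      omega
    · simp only [stripRel, stripAdj]; omega

/-! ### Ladders on well-orders and antichains of sets -/

/-- Where no cofinal sequence exists below a, the default ladder is constantly a, which keeps the
first clause true. -/
theorem exists_ladder (I : Type u) [LinearOrder I] : ∃ l : I → ℕ → I,
    (∀ a b, b < a → ∃ n, b ≤ l a n) ∧
    ∀ a, ∀ s : ℕ → I, (∀ n, s n < a) → (∀ b < a, ∃ n, b ≤ s n) → ∀ n, l a n < a := by
  classical
  let P : I → (ℕ → I) → Prop := fun a s => (∀ n, s n < a) ∧ ∀ b < a, ∃ n, b ≤ s n
  refine ⟨fun a => if h : ∃ s, P a s then h.choose else fun _ => a,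
    fun a b hb => ?_, fun a s hs hs' n => ?_⟩
  · by_cases h : ∃ s, P a s
    · simpa only [dif_pos h] using h.choose_spec.2 b hb
    · simpa only [dif_neg h] using ⟨0, hb.le⟩
  · have h : ∃ s, P a s := ⟨s, hs, hs'⟩
    simpa only [dif_pos h] using h.choose_spec.1 n

/-- If a < g a, let c be the least strict upper bound of the iterates of g at a. The ladder of c
stays below c, and commutation forces g c = c, so g fixes each rung. A rung above a then bounds all
iterates, contradicting minimality. -/
theorem StrictMono.eq_of_ladder {I : Type u} [LinearOrder I] [WellFoundedLT I] [OrderTop I]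
    {l : I → ℕ → I} (hcof : ∀ a b, b < a → ∃ n, b ≤ l a n)
    (hlt : ∀ a, ∀ s : ℕ → I, (∀ n, s n < a) → (∀ b < a, ∃ n, b ≤ s n) → ∀ n, l a n < a)
    {g : I → I} (hg : StrictMono g) (hgl : ∀ a n, g (l a n) = l (g a) n) (a : I) : g a = a := by
  by_contra hne
  have ha : a < g a := lt_of_le_of_ne (hg.le_apply) (Ne.symm hne)
  have hs : StrictMono fun n => g^[n] a := by
    refine strictMono_nat_of_lt_succ fun n => ?_
    rw [Function.iterate_succ_apply]
    exact hg.iterate n ha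
  obtain ⟨c, hc, hmin⟩ := WellFounded.has_min (wellFounded_lt (α := I))
    {c | ∀ n, g^[n] a < c} ⟨⊤, fun n => lt_of_lt_of_le (hs (Nat.lt_succ_self n)) le_top⟩
  have hmin' : ∀ b < c, ∃ n, b ≤ g^[n] a := by
    intro b hb
    by_contra! h
    exact hmin b h hb
  have hl := hlt c _ hc hmin'
  have hgc : g c = c := by
    refine le_antisymm (not_lt.1 fun h => ?_) hg.le_apply
    obtain ⟨n, hn⟩ := hcof _ _ h
    obtain ⟨m, hm⟩ := hmin' _ (hl n)
    rw [← hgl] at hn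
    have h1 := hg.monotone hm
    rw [← Function.iterate_succ_apply' g] at h1
    exact absurd (hc (m + 1)) (not_lt.2 (hn.trans h1))
  obtain ⟨n, hn⟩ := hcof c a (hc 0)
  have hfix : g (l c n) = l c n := by rw [hgl, hgc]
  obtain ⟨m, hm⟩ := hmin' _ (hl n)
  have h1 : g^[m + 1] a ≤ l c n :=
    ((hg.monotone.iterate (m + 1)) hn).trans_eq (Function.iterate_fixed hfix _)
  exact absurd (hs (Nat.lt_succ_self m)) (not_lt.2 (h1.trans hm))

/-- Coding a set together with its complement turns inclusion into equality. -/
theorem exists_antichain {I X : Type u} [Infinite I] (h : Cardinal.mk X ≤ 2 ^ Cardinal.mk I) :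
    ∃ N : X → Set I, ∀ y z, N y ⊆ N z → y = z := by
  rw [← Cardinal.mk_set] at h
  obtain ⟨φ⟩ := h
  have : Cardinal.mk (I ⊕ I) = Cardinal.mk I := by
    rw [Cardinal.mk_sum, Cardinal.lift_id, Cardinal.add_eq_self (Cardinal.aleph0_le_mk I)]
  obtain ⟨e⟩ := Cardinal.eq.1 this
  refine ⟨fun y => {i | Sum.elim (fun a => a ∈ φ y) (fun a => a ∉ φ y) (e.symm i)},
    fun y z hyz => φ.injective (Set.ext fun a => ⟨fun ha => ?_, fun ha => ?_⟩)⟩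
  · have : e (Sum.inl a) ∈ {i | Sum.elim (fun a => a ∈ φ z) (fun a => a ∉ φ z) (e.symm i)} :=
      hyz (by simpa using ha)
    simpa using this
  · by_contra hn
    have : e (Sum.inr a) ∈ {i | Sum.elim (fun a => a ∈ φ z) (fun a => a ∉ φ z) (e.symm i)} :=
      hyz (by simpa using hn)
    exact absurd ha (by simpa using this)

/-! ### The coding graph and its triangles -/

/-- The vertices of the graph coding a well-order on `I` and a family of subsets of `I` indexed by
`X`: the vertices `d` of a rigid finite graph, vertices `v b` for the elements of `I`, a path
`w a 0, w a 1, …` for each element `a` of `I`, and vertices `x y` for the elements of `X`. -/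
inductive CodeVertex (I X : Type u) : Type u
  | d (i : Fin 41)
  | v (b : I)
  | w (a : I) (n : ℕ)
  | x (y : X)

namespace CodeVertex

variable {I X : Type u}

/-- The sort of a vertex; the vertices outside the finite rigid graph have a sort less than `6`. -/
def tag : CodeVertex I X → ℕ
  | d _ => 6
  | v _ => 4
  -- Sort 0 is reserved for starts of paths; residues mod 3 tell the successor from the predecessor.
  | w _ n => if n = 0 then 0 else 1 + n % 3
  | x _ => 5

/-- The two vertices of the finite rigid graph that mark the vertices of sort `t`. -/
def Marks (i : Fin 41) (t : ℕ) : Prop := i.val = 12 + t ∨ i.val = 20 + t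

theorem eq_d_of_tag {p : CodeVertex I X} (h : ¬ p.tag < 6) : ∃ i, p = d i := by
  cases p with
  | d i => exact ⟨i, rfl⟩
  | _ => exfalso; apply h; simp only [tag]; (try split_ifs) <;> omega

theorem eq_v_of_tag {p : CodeVertex I X} (h : p.tag = 4) : ∃ b, p = v b := by
  cases p with
  | v b => exact ⟨b, rfl⟩
  | w a n => exfalso; simp only [tag] at h; split_ifs at h; omega
  | _ => simp [tag] at h

theorem eq_x_of_tag {p : CodeVertex I X} (h : p.tag = 5) : ∃ y, p = x y := by
  cases p with
  | x y => exact ⟨y, rfl⟩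
  | w a n => exfalso; simp only [tag] at h; split_ifs at h; omega
  | _ => simp [tag] at h

theorem eq_w_of_tag {p : CodeVertex I X} (h : p.tag = 0) : ∃ a, p = w a 0 := by
  cases p with
  | w a n =>
    simp only [tag] at h
    split_ifs at h with hn
    · exact ⟨a, by rw [hn]⟩
    · omega
  | _ => simp [tag] at h

variable [LinearOrder I] (l : I → ℕ → I) (N : X → Set I)

/-- The edges of the coding graph, each in one direction. -/
def Edge : CodeVertex I X → CodeVertex I X → Prop
  | d i, d j => stripRel 1 41 i j
  | d i, v _ => Marks i 4
  | d i, w _ n => Marks i (if n = 0 then 0 else 1 + n % 3)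
  | d i, x _ => Marks i 5
  -- Index 0 codes a < b, index 1 ties the path to v a, and odd indices from 3 on carry the ladder;
  -- this spacing avoids triangles.
  | w a n, v b => (n = 0 ∧ a < b) ∨ (n = 1 ∧ b = a) ∨ ∃ k, n = 2 * k + 3 ∧ b = l a k
  | w a n, w c m => a = c ∧ m = n + 1
  | x y, w a n => n = 0 ∧ a ∈ N y
  | _, _ => False

/-- Adjacency in the coding graph. -/
def Adj (p q : CodeVertex I X) : Prop := Edge l N p q ∨ Edge l N q p

variable {l N}

theorem Adj.symm {p q : CodeVertex I X} (h : Adj l N p q) : Adj l N q p := Or.symm h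

theorem adj_d_d {i j : Fin 41} : Adj l N (d i : CodeVertex I X) (d j) ↔ stripRel 1 41 i j :=
  ⟨fun h => h.elim id stripRel_symm, Or.inl⟩

theorem adj_d {i : Fin 41} {p : CodeVertex I X} (hp : p.tag < 6) :
    Adj l N (d i) p ↔ Marks i p.tag := by
  cases p with
  | d j => simp [tag] at hp
  | _ => simp [Adj, Edge, tag]

theorem tag_ne_of_adj {p q : CodeVertex I X} (hp : p.tag < 6) (hq : q.tag < 6)
    (h : Adj l N p q) : p.tag ≠ q.tag := by
  cases p <;> cases q <;> simp only [tag, Adj, Edge] at * <;> grind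

theorem eq_w_succ {a : I} {n : ℕ} {q : CodeVertex I X} (h : Adj l N (w a n) q)
    (ht : q.tag = (w a (n + 1) : CodeVertex I X).tag) : q = w a (n + 1) := by
  cases q with
  | w c m =>
    simp only [tag, Adj, Edge] at *
    rcases h with ⟨rfl, rfl⟩ | ⟨rfl, rfl⟩
    · rfl
    · exfalso
      split_ifs at ht <;> omega
  | _ => exfalso; simp only [tag] at ht; split_ifs at ht <;> omega

theorem no_triangle {p q r : CodeVertex I X} (hp : p.tag < 6)
    (hq : q.tag < 6) (hr : r.tag < 6) (hpq : Adj l N p q) (hqr : Adj l N q r)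
    (hpr : Adj l N p r) : False := by
  -- Consecutive path vertices can share v b only at indices 0 and 1, which would need both a < b
  -- and b = a.
  have hwwv : ∀ a n c m b, Adj l N (w a n : CodeVertex I X) (w c m) → Adj l N (w a n) (v b) →
      Adj l N (w c m) (v b) → False := by
    intro a n c m b h1 h2 h3
    simp only [Adj, Edge, or_false] at h1 h2 h3
    have : a = c ∧ (m = n + 1 ∨ n = m + 1) := by tauto
    obtain ⟨rfl, h⟩ := this
    rcases h2 with ⟨rfl, h2⟩ | ⟨rfl, h2⟩ | ⟨k, rfl, h2⟩ <;>
    rcases h3 with ⟨rfl, h3⟩ | ⟨rfl, h3⟩ | ⟨k', rfl, h3⟩ <;>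
    first
      | omega
      | exact absurd h2 (by rw [h3]; exact lt_irrefl _)
      | exact absurd h3 (by rw [h2]; exact lt_irrefl _)
  have hwwx : ∀ a n c m y, Adj l N (w a n : CodeVertex I X) (w c m) → Adj l N (w a n) (x y) →
      Adj l N (w c m) (x y) → False := by
    intro a n c m y h1 h2 h3
    simp only [Adj, Edge, false_or] at h1 h2 h3
    omega
  have hwww : ∀ a n c m e k, Adj l N (w a n : CodeVertex I X) (w c m) → Adj l N (w a n) (w e k) →
      Adj l N (w c m : CodeVertex I X) (w e k) → False := by
    intro a n c m e k h1 h2 h3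
    simp only [Adj, Edge] at h1 h2 h3
    omega
  have hvv : ∀ b c, ¬ Adj l N (v b : CodeVertex I X) (v c) := by simp [Adj, Edge]
  have hvx : ∀ b y, ¬ Adj l N (v b : CodeVertex I X) (x y) := by simp [Adj, Edge]
  have hxx : ∀ b y, ¬ Adj l N (x b : CodeVertex I X) (x y) := by simp [Adj, Edge]
  cases p <;> cases q <;> cases r <;> first
    | (simp [tag] at hp hq hr; done)
    | exact hvv _ _ ‹_›
    | exact hxx _ _ ‹_›
    | exact hvx _ _ ‹_›
    | exact hvx _ _ (Adj.symm ‹_›)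
    | exact hwww _ _ _ _ _ _ hpq hpr hqr
    | exact hwwv _ _ _ _ _ hpq hpr hqr
    | exact hwwv _ _ _ _ _ hpr hpq hqr.symm
    | exact hwwv _ _ _ _ _ hqr hpq.symm hpr.symm
    | exact hwwx _ _ _ _ _ hpq hpr hqr
    | exact hwwx _ _ _ _ _ hpr hpq hqr.symm
    | exact hwwx _ _ _ _ _ hqr hpq.symm hpr.symm

/-- Adjacent vertices outside the strip differ in sort and share no mark, while the two marks of one
sort are not adjacent. -/
theorem eq_d_of_triangle {p q r : CodeVertex I X}
    (hpq : Adj l N p q) (hqr : Adj l N q r) (hpr : Adj l N p r) : ∃ i, p = d i := by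
  by_contra hne
  have hp : p.tag < 6 := by
    by_contra h
    exact hne (eq_d_of_tag h)
  have mixed : ∀ q r : CodeVertex I X, Adj l N p q → Adj l N q r → Adj l N p r →
      q.tag < 6 → ¬ r.tag < 6 → False := by
    intro q r hpq hqr hpr hq hr
    obtain ⟨i, rfl⟩ := eq_d_of_tag hr
    have h1 := (adj_d hp).1 hpr.symm
    have h2 := (adj_d hq).1 hqr.symm
    have h3 := tag_ne_of_adj hp hq hpq
    unfold Marks at h1 h2
    omega
  by_cases hq : q.tag < 6 <;> by_cases hr : r.tag < 6
  · exact no_triangle hp hq hr hpq hqr hpr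
  · exact mixed q r hpq hqr hpr hq hr
  · exact mixed r q hpr hqr.symm hpq hr hq
  · obtain ⟨i, rfl⟩ := eq_d_of_tag hq
    obtain ⟨j, rfl⟩ := eq_d_of_tag hr
    have h1 := (adj_d hp).1 hpq.symm
    have h2 := (adj_d hp).1 hpr.symm
    have h3 := adj_d_d.1 hqr
    unfold Marks at h1 h2
    unfold stripRel stripAdj at h3
    omega

theorem exists_strip_triangle (i : Fin 41) : ∃ j k : Fin 41, stripRel 1 41 i j ∧
    stripRel 1 41 j k ∧ stripRel 1 41 i k := by
  by_cases h : i.val < 39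
  · refine ⟨⟨i + 1, by omega⟩, ⟨i + 2, by omega⟩, ?_⟩
    simp only [stripRel, stripAdj]
    omega
  · refine ⟨⟨i - 1, by omega⟩, ⟨i - 2, by omega⟩, ?_⟩
    simp only [stripRel, stripAdj]
    omega

/-! ### Homomorphisms of the coding graph -/

section Hom

variable {S : Set (CodeVertex I X)}
  {F : CodeVertex I X → CodeVertex I X}

theorem hom_d (hd : ∀ i, d i ∈ S)
    (hF : ∀ a ∈ S, ∀ b ∈ S, Adj l N a b → Adj l N (F a) (F b)) (i : Fin 41) : F (d i) = d i := by
  have h : ∀ i, ∃ j, F (d i) = d j := by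
    intro i
    obtain ⟨j, k, h1, h2, h3⟩ := exists_strip_triangle i
    exact eq_d_of_triangle (hF _ (hd i) _ (hd j) (adj_d_d.2 h1))
      (hF _ (hd j) _ (hd k) (adj_d_d.2 h2)) (hF _ (hd i) _ (hd k) (adj_d_d.2 h3))
  choose φ hφ using h
  rw [hφ, (rigidRel_strip (b := 1) (n := 41) (Or.inl rfl) (by norm_num) (by norm_num)).2 φ
    fun a b hab => ?_]
  have := hF _ (hd a) _ (hd b) (adj_d_d.2 hab)
  rwa [hφ, hφ, adj_d_d] at this

/-- The two marks of a sort are 8 apart, so no strip vertex is adjacent to both. The image thus lies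
off the strip, where a mark determines the sort. -/
theorem tag_hom (hd : ∀ i, d i ∈ S)
    (hF : ∀ a ∈ S, ∀ b ∈ S, Adj l N a b → Adj l N (F a) (F b)) {p : CodeVertex I X} (hpS : p ∈ S)
    (hp : p.tag < 6) : (F p).tag = p.tag := by
  have h : ∀ i, Marks i p.tag → Adj l N (d i) (F p) := by
    intro i hi
    have := hF _ (hd i) _ hpS ((adj_d hp).2 hi)
    rwa [hom_d hd hF] at this
  have h1 := h ⟨12 + p.tag, by omega⟩ (Or.inl rfl)
  have h2 := h ⟨20 + p.tag, by omega⟩ (Or.inr rfl)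
  by_cases hq : (F p).tag < 6
  · rw [adj_d hq] at h1
    unfold Marks at h1
    simp only at h1
    omega
  · exfalso
    obtain ⟨j, hj⟩ := eq_d_of_tag hq
    rw [hj, adj_d_d] at h1 h2
    unfold stripRel stripAdj at h1 h2
    simp only at h1 h2
    omega

theorem hom_eq [WellFoundedLT I] [OrderTop I] (hcof : ∀ a b, b < a → ∃ n, b ≤ l a n)
    (hlt : ∀ a, ∀ s : ℕ → I, (∀ n, s n < a) → (∀ b < a, ∃ n, b ≤ s n) → ∀ n, l a n < a)
    (hN : ∀ y z, N y ⊆ N z → y = z) (hS : ∀ p : CodeVertex I X, p.tag ≠ 5 → p ∈ S)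
    (hF : ∀ a ∈ S, ∀ b ∈ S, Adj l N a b → Adj l N (F a) (F b)) : ∀ p ∈ S, F p = p := by
  have hd : ∀ i, d i ∈ S := fun i => hS _ (by simp [tag])
  have hv : ∀ b, v b ∈ S := fun b => hS _ (by simp [tag])
  have hw : ∀ a n, w a n ∈ S := fun a n => hS _ (by simp only [tag]; split_ifs <;> omega)
  have ht : ∀ {p}, p ∈ S → p.tag < 6 → (F p).tag = p.tag := fun h h' => tag_hom hd hF h h'
  have hwt : ∀ a n, (w a n : CodeVertex I X).tag < 6 := by
    intro a n
    simp only [tag]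
    split_ifs <;> omega
  have h0 : ∀ a, ∃ c, F (w a 0) = w c 0 := fun a => eq_w_of_tag (ht (hw a 0) (hwt a 0))
  have h1 : ∀ b, ∃ c, F (v b) = v c := fun b => eq_v_of_tag (ht (hv b) (by simp [tag]))
  choose g hg using h0
  choose h hh using h1
  have hgw : ∀ a n, F (w a n) = w (g a) n := by
    intro a n
    induction n with
    | zero => exact hg a
    | succ n ih =>
      refine eq_w_succ (l := l) (N := N) ?_ (ht (hw a (n + 1)) (hwt a _))
      rw [← ih]
      exact hF _ (hw _ _) _ (hw _ _) (Or.inl ⟨rfl, rfl⟩)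
  have hwv : ∀ a n b, Edge l N (w a n : CodeVertex I X) (v b) →
      Edge l N (w (g a) n : CodeVertex I X) (v (h b)) := by
    intro a n b hab
    have := hF _ (hw a n) _ (hv b) (Or.inl hab)
    rw [hgw, hh] at this
    exact this.resolve_right id
  have hhg : ∀ a, h a = g a := by
    intro a
    have := hwv a 1 a (Or.inr (Or.inl ⟨rfl, rfl⟩))
    simp only [Edge] at this
    rcases this with h | h | ⟨k, h, -⟩
    · omega
    · exact h.2
    · omega
  have hmono : StrictMono g := by
    intro a b hab
    have := hwv a 0 b (Or.inl ⟨rfl, hab⟩)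
    simp only [Edge] at this
    rcases this with h | h | ⟨k, h, -⟩
    · rw [← hhg b]; exact h.2
    · omega
    · omega
  have hgl : ∀ a n, g (l a n) = l (g a) n := by
    intro a n
    have := hwv a (2 * n + 3) (l a n) (Or.inr (Or.inr ⟨n, rfl, rfl⟩))
    simp only [Edge] at this
    rcases this with h | h | ⟨k, hk, hk'⟩
    · omega
    · omega
    · obtain rfl : n = k := by omega
      rw [← hhg]; exact hk'
  have hid : ∀ a, g a = a := hmono.eq_of_ladder hcof hlt hgl
  intro p hp
  cases p with
  | d i => exact hom_d hd hF i
  | v b => rw [hh, hhg, hid]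
  | w a n => rw [hgw, hid]
  | x y =>
    obtain ⟨z, hz⟩ := eq_x_of_tag (ht hp (by simp [tag]))
    rw [hz, hN y z fun a ha => ?_]
    have := hF _ hp _ (hw a 0) (Or.inl ⟨rfl, ha⟩)
    rw [hz, hgw, hid] at this
    exact (this.resolve_right id).2

end Hom

end CodeVertex

/-! ### Cardinalities and conclusion -/

theorem RigidRel.diamondCondition {A : Type u} {V : Type*} {R : V → V → Prop} (hR : RigidRel R)
    (e : A ≃ V) {κ : Cardinal.{u}} (hA : Cardinal.mk A ≤ κ) :
    DiamondCondition κ fun a b => R (e a) (e b) := by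
  refine fun x => ⟨Set.univ, Set.subset_univ _, by rwa [Cardinal.mk_univ], fun f hf hhom => hf ?_⟩
  funext a
  have := hR.2 (fun v => e (f ⟨e.symm v, trivial⟩)) (fun u v huv => hhom _ _ (by simpa using huv))
    (e a)
  simpa using this

theorem DiamondCondition.of_equiv {A B : Type u} {κ : Cardinal.{u}} {R : B → B → Prop}
    (hR : DiamondCondition κ R) (e : A ≃ B) : DiamondCondition κ fun a b => R (e a) (e b) := by
  intro x
  obtain ⟨S, hxS, hS, h⟩ := hR (e x)
  refine ⟨e ⁻¹' S, by simpa using hxS, ?_, fun f hf hhom => ?_⟩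
  · rwa [Cardinal.mk_preimage_equiv]
  · refine h (fun s => e (f ⟨e.symm s, by simp⟩)) (fun heq => hf ?_)
      (fun a b hab => hhom _ _ (by simpa using hab))
    funext a
    have := congrFun heq ⟨e a, a.2⟩
    simpa using this

namespace CodeVertex

/-- The vertices of the coding graph as a sum type. -/
def equivSum (I X : Type u) : CodeVertex I X ≃ (Fin 41 ⊕ I ⊕ I × ℕ) ⊕ X where
  toFun
    | d i => Sum.inl (Sum.inl i)
    | v b => Sum.inl (Sum.inr (Sum.inl b))
    | w a n => Sum.inl (Sum.inr (Sum.inr (a, n)))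
    | x y => Sum.inr y
  invFun
    | Sum.inl (Sum.inl i) => d i
    | Sum.inl (Sum.inr (Sum.inl b)) => v b
    | Sum.inl (Sum.inr (Sum.inr (a, n))) => w a n
    | Sum.inr y => x y
  left_inv p := by cases p <;> rfl
  right_inv p := by rcases p with (_ | _ | _) | _ <;> rfl

theorem mk_base (I : Type u) [Infinite I] :
    Cardinal.mk (Fin 41 ⊕ I ⊕ I × ℕ) = Cardinal.mk I := by
  have h := Cardinal.aleph0_le_mk I
  simp only [Cardinal.mk_sum, Cardinal.mk_prod, Cardinal.lift_id, Cardinal.lift_uzero,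
    Cardinal.mk_fin, Cardinal.mk_nat, Cardinal.lift_aleph0, Cardinal.lift_natCast]
  rw [Cardinal.mul_aleph0_eq h, Cardinal.add_eq_self h,
    Cardinal.add_eq_right h ((Cardinal.natCast_lt_aleph0).le.trans h)]

theorem diamondCondition {I X : Type u} [LinearOrder I] [WellFoundedLT I] [OrderTop I]
    [Infinite I] {l : I → ℕ → I} {N : X → Set I} (hcof : ∀ a b, b < a → ∃ n, b ≤ l a n)
    (hlt : ∀ a, ∀ s : ℕ → I, (∀ n, s n < a) → (∀ b < a, ∃ n, b ≤ s n) → ∀ n, l a n < a)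
    (hN : ∀ y z, N y ⊆ N z → y = z) : DiamondCondition (Cardinal.mk I) (Adj l N) := by
  classical
  intro p
  refine ⟨insert p (Set.range fun q => (equivSum I X).symm (Sum.inl q)), by simp, ?_,
    fun f hf hhom => hf ?_⟩
  · refine (Cardinal.mk_insert_le).trans ?_
    rw [← Cardinal.add_one_eq (Cardinal.aleph0_le_mk I)]
    gcongr
    refine Cardinal.mk_range_le.trans (mk_base I).le
  · funext a
    have := hom_eq (F := fun q => if h : q ∈ insert p (Set.range fun q =>
      (equivSum I X).symm (Sum.inl q)) then f ⟨q, h⟩ else q) hcof hlt hN (fun q hq => ?_)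
      (fun q hq r hr hqr => ?_) a a.2
    · simpa only [dif_pos a.2] using this
    · refine Or.inr ?_
      cases q with
      | d i => exact ⟨Sum.inl i, rfl⟩
      | v b => exact ⟨Sum.inr (Sum.inl b), rfl⟩
      | w a n => exact ⟨Sum.inr (Sum.inr (a, n)), rfl⟩
      | x y => simp [tag] at hq
    · simp only [dif_pos hq, dif_pos hr]
      exact hhom ⟨q, hq⟩ ⟨r, hr⟩ hqr

end CodeVertex

theorem DiamondCondition.mono {A : Type u} {κ μ : Cardinal.{u}} {R : A → A → Prop}
    (h : DiamondCondition κ R) (hκ : κ ≤ μ) : DiamondCondition μ R := fun x =>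
  let ⟨S, h1, h2, h3⟩ := h x
  ⟨S, h1, h2.trans hκ, h3⟩

theorem exists_diamondCondition_of_infinite {A : Type u} [Infinite A] (κ : Cardinal.{u})
    (hκ : Cardinal.aleph0 ≤ κ) (hA : Cardinal.mk A ≤ 2 ^ κ) :
    ∃ R : A → A → Prop, (∀ a b : A, R a b → R b a) ∧ DiamondCondition κ R := by
  -- The minimum makes the coding graph equinumerous with A while 2 ^ card K still bounds card A.
  obtain ⟨K, hK⟩ : ∃ K : Type u, Cardinal.mk K = min κ (Cardinal.mk A) := ⟨_, Cardinal.mk_out _⟩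
  have hK0 : Cardinal.aleph0 ≤ Cardinal.mk K := hK ▸ le_min hκ (Cardinal.aleph0_le_mk A)
  obtain ⟨_, _⟩ := exists_wellFoundedLT K
  have hI : Cardinal.mk (WithTop K) = Cardinal.mk K :=
    (Cardinal.mk_option (α := K)).trans (Cardinal.add_one_eq hK0)
  have : Infinite (WithTop K) := Cardinal.infinite_iff.2 (hI ▸ hK0)
  have hAI : Cardinal.mk A ≤ 2 ^ Cardinal.mk (WithTop K) := by
    rw [hI, hK]
    rcases le_total κ (Cardinal.mk A) with h | h
    · rwa [min_eq_left h]
    · rw [min_eq_right h]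
      exact (Cardinal.cantor _).le
  obtain ⟨N, hN⟩ := exists_antichain hAI
  obtain ⟨l, hcof, hlt⟩ := exists_ladder (WithTop K)
  have hcard : Cardinal.mk A = Cardinal.mk (CodeVertex (WithTop K) A) := by
    rw [(Cardinal.mk_congr (CodeVertex.equivSum (WithTop K) A)), Cardinal.mk_sum,
      CodeVertex.mk_base, hI, hK, Cardinal.lift_id, Cardinal.lift_id,
      Cardinal.add_eq_right (Cardinal.aleph0_le_mk A) (min_le_right _ _)]
  obtain ⟨e⟩ := Cardinal.eq.1 hcard
  refine ⟨_, fun a b h => ?_, ((CodeVertex.diamondCondition hcof hlt hN).mono ?_).of_equiv e⟩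
  · exact CodeVertex.Adj.symm h
  · rw [hI, hK]
    exact min_le_left _ _

theorem theorem4 {A : Type u} (κ : Cardinal.{u}) (hκ : Cardinal.aleph0 ≤ κ)
    (hA : Cardinal.mk A ≤ 2 ^ κ)
    (hsmall : Cardinal.mk A ≤ 1 ∨ 8 ≤ Cardinal.mk A) :
    ∃ R : A → A → Prop, (∀ a b : A, R a b → R b a) ∧ DiamondCondition κ R := by
  rcases finite_or_infinite A with hfin | hinf
  · have hAκ : Cardinal.mk A ≤ κ := (Cardinal.mk_lt_aleph0).le.trans hκ
    rcases hsmall with h1 | h8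
    · have : Subsingleton A := Cardinal.le_one_iff_subsingleton.1 h1
      have hR : RigidRel fun _ _ : A => False := ⟨fun _ _ h => h, fun _ _ _ => Subsingleton.elim _ _⟩
      exact ⟨_, fun _ _ h => h, hR.diamondCondition (Equiv.refl A) hAκ⟩
    · have hn : 8 ≤ Nat.card A := by
        rw [← Nat.cast_card] at h8
        exact_mod_cast h8
      obtain ⟨R, hR⟩ := exists_rigidRel_fin hn
      exact ⟨_, fun a b h => hR.1 _ _ h, hR.diamondCondition (Finite.equivFin A) hAκ⟩
  · exact exists_diamondCondition_of_infinite κ hκ hA
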